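/- Let $r\colon\mathbb R\to\mathbb R$ be a $C^1$ function and $R_0$ a constant with $|r(t)|\le R_0$ and $|r'(t)|\le R_0$ for all $t\in\mathbb R$. For $(\sigma,b)\in(0,\infty)^2$ consider on $\mathbb R^3$ the non-autonomous Lorenz system $$x'=-\sigma x+\sigma y,\qquad y'=r(t)x-y-xz,\qquad z'=-bz+xy .$$ For every $(\sigma,b)\in(0,\infty)^2$ and all $s\in\mathbb R$, $v_0\in\mathbb R^3$, the system has exactly one solution $v$ on $[s,\infty)$ with $v(s)=v_0$, and $S_{\sigma,b}(t,s)v_0:=v(t)$ defines a process: $S_{\sigma,b}(t,t)=\mathrm{id}$, $S_{\sigma,b}(t,\tau)S_{\sigma,b}(\tau,s)=S_{\sigma,b}(t,s)$ for $t\ge\tau\ge s$, and $S_{\sigma,b}(t,s)v_0$ is jointly continuous in $(t,s,v_0)$, $t\ge s$. Write $\rho(A,C)=\sup_{a\in A}\inf_{c\in C}|a-c|$. This process has - a pullback attractor $\mathscr A_{\sigma,b}(\cdot)$: a family of non-empty compact sets $\mathscr A_{\sigma,b}(t)$, $t\in\mathbb R$, with $S_{\sigma,b}(t,s)\mathscr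 A_{\sigma,b}(s)=\mathscr A_{\sigma,b}(t)$ for all $t\ge s$ and $\rho(S_{\sigma,b}(t,s)B,\mathscr A_{\sigma,b}(t))\to0$ as $s\to-\infty$ for every bounded $B$ and every $t$, which for each $t$ is contained in $C(t)$ for any other family $C(\cdot)$ of compact sets with these two properties; - a uniform attractor $\mathbb A_{\sigma,b}$: a non-empty compact set with $\sup_{s\in\mathbb R}\rho(S_{\sigma,b}(t+s,s)B,\mathbb A_{\sigma,b})\to0$ as $t\to\infty$ for every bounded $B$, which is contained in any other compact set with this property. Moreover, there is a residual (its complement is a countable union of nowhere dense sets) and dense subset $\Lambda_*$ of $(0,\infty)^2$ such that at every point of $\Lambda_*$ the map $(\sigma,b)\mapsto\mathscr A_{\sigma,b}(t)$, for every $t\in\mathbb R$, and the map $(\sigma,b)\mapsto\mathbb A_{\sigma,b}$ are continuous from $(0,\infty)^2$ into the space of non-empty closed bounded subsets of $\mathbb R^3$ with the symmetric Hausdorff metric $\max(\rho(A,C),\rho(C,A))$. -/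

import Mathlib

open Set Filter Topology
open scoped ENNReal

/-- Three-dimensional Euclidean space, the phase space of the Lorenz system. -/
abbrev E3 : Type := EuclideanSpace ℝ (Fin 3)

/-- The parameter space `(0,∞)²` of pairs `(σ, b)`, with its topology as a subspace of the plane. -/
abbrev LorenzParam : Type := {p : ℝ × ℝ // 0 < p.1 ∧ 0 < p.2}

namespace NonautonomousLorenz

/-- The Hausdorff semi-distance `ρ(A, C) = sup_{a ∈ A} inf_{c ∈ C} d(a, c)`, with values in
`[0,∞]`, so that no junk value occurs for unbounded or empty sets. -/
noncomputable def semiDist {X : Type*} [MetricSpace X] (A C : Set X) : ℝ≥0∞ :=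
  ⨆ a ∈ A, Metric.infEDist a C

/-- A process on `X`: a two-parameter family of maps `S t s : X → X`, where only the values for
`s ≤ t` matter. -/
structure IsProcess {X : Type*} [MetricSpace X] (S : ℝ → ℝ → X → X) : Prop where
  refl : ∀ (t : ℝ) (x : X), S t t x = x
  comp : ∀ (s τ t : ℝ), s ≤ τ → τ ≤ t → ∀ x : X, S t τ (S τ s x) = S t s x
  /-- `S t s x` is (jointly) continuous in `t`, `s` and `x` on the set where `s ≤ t`. -/
  continuousOn :
    ContinuousOn (fun q : ℝ × ℝ × X => S q.1 q.2.1 q.2.2) {q : ℝ × ℝ × X | q.2.1 ≤ q.1}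

/-- Invariance of a family of sets: `S(t,s) A(s) = A(t)` for all `t ≥ s`. -/
def IsInvariantFamily {X : Type*} (S : ℝ → ℝ → X → X) (A : ℝ → Set X) : Prop :=
  ∀ s t : ℝ, s ≤ t → S t s '' A s = A t

/-- Pullback attraction: `ρ(S(t,s) B, A(t)) → 0` as `s → -∞`, for every bounded `B` and
every `t`. -/
def IsPullbackAttracting {X : Type*} [MetricSpace X] (S : ℝ → ℝ → X → X) (A : ℝ → Set X) :
    Prop :=
  ∀ B : Set X, Bornology.IsBounded B → ∀ t : ℝ,
    Tendsto (fun s : ℝ => semiDist (S t s '' B) (A t)) atBot (𝓝 0)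

/-- `A(·)` is the pullback attractor of `S`: the minimal family of compact sets that is invariant
and pullback attracting. By minimality there is at most one. -/
structure IsPullbackAttractor {X : Type*} [MetricSpace X] (S : ℝ → ℝ → X → X)
    (A : ℝ → Set X) : Prop where
  isCompact : ∀ t : ℝ, IsCompact (A t)
  invariant : IsInvariantFamily S A
  attracting : IsPullbackAttracting S A
  minimal : ∀ C : ℝ → Set X, (∀ t : ℝ, IsCompact (C t)) → IsInvariantFamily S C →
    IsPullbackAttracting S C → ∀ t : ℝ, A t ⊆ C t

/-- Uniform attraction: `sup_s ρ(S(t+s,s) B, K) → 0` as `t → ∞`, for every bounded `B`. -/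
def IsUniformlyAttracting {X : Type*} [MetricSpace X] (S : ℝ → ℝ → X → X) (K : Set X) : Prop :=
  ∀ B : Set X, Bornology.IsBounded B →
    Tendsto (fun t : ℝ => ⨆ s : ℝ, semiDist (S (t + s) s '' B) K) atTop (𝓝 0)

/-- `K` is the uniform attractor of `S`: the minimal compact uniformly attracting set. By
minimality there is at most one. -/
structure IsUniformAttractor {X : Type*} [MetricSpace X] (S : ℝ → ℝ → X → X)
    (K : Set X) : Prop where
  isCompact : IsCompact K
  attracting : IsUniformlyAttracting S K
  minimal : ∀ C : Set X, IsCompact C → IsUniformlyAttracting S C → K ⊆ C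

/-- The right-hand side of the Lorenz system `x' = -σx + σy`, `y' = r(t)x - y - xz`,
`z' = -bz + xy` with forcing `r`, at time `t` and state `v = (x, y, z)`. -/
noncomputable def lorenzField (r : ℝ → ℝ) (σ b t : ℝ) (v : E3) : E3 :=
  !₂[-σ * v 0 + σ * v 1, r t * v 0 - v 1 - v 0 * v 2, -b * v 2 + v 0 * v 1]

/-- `v` solves the Lorenz system on `[s,∞)` (with the one-sided derivative at `s`). -/
def IsLorenzSolution (r : ℝ → ℝ) (σ b s : ℝ) (v : ℝ → E3) : Prop :=
  ∀ t ∈ Ici s, HasDerivWithinAt v (lorenzField r σ b t (v t)) (Ici s) t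

/-- The Lorenz system generates `S`: for every initial time `s` and initial state `x`, the
initial value problem has exactly one solution on `[s,∞)`, namely `t ↦ S t s x`. -/
def LorenzGenerates (r : ℝ → ℝ) (σ b : ℝ) (S : ℝ → ℝ → E3 → E3) : Prop :=
  ∀ (s : ℝ) (x : E3) (v : ℝ → E3),
    (v s = x ∧ IsLorenzSolution r σ b s v) ↔ EqOn v (fun t => S t s x) (Ici s)

end NonautonomousLorenz

/-! Everything rests on the energy `V = (β/σ)x² + y² + (z - β)²` with `β = R₀² + 1`. Along solutions
the cubic terms cancel and `V' ≤ -kV + bβ²`, where `k = min(σ, b, 1)` (`lorenzEnergyDeriv_le`). So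
solutions are global, and a sublevel set `K` of `V` is compact, positively invariant and absorbs
bounded sets after a time independent of the initial time; its size is locally bounded in `(σ, b)`.

Such a `K` yields both attractors by compactness: the pullback attractor is `⋂ S(t,s)K` over `s ≤
t`, the uniform one the intersection over `h ≥ 0` of the closures of all states reached from `K`
after time `h`.

Grönwall's inequality makes the process continuous in the parameters over a finite time span,
uniformly in the initial time and on bounded sets. As attraction takes effect within a finite time,
both attractors are upper semicontinuous in `(σ, b)`. An upper semicontinuous compact-valued map is
lower semicontinuous off countably many nowhere dense sets (`exists_residual_lower_semicontinuous`).
For the uncountably many times `t` it suffices to do this at integer times, since invariance carries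
lower semicontinuity forward (`pullback_lower_of_le`). Density of the residual set is Baire's
theorem. -/

namespace NonautonomousLorenz

/-! ### Semi-distance and thickenings. -/

section SemiDist

variable {X : Type*} [MetricSpace X]

theorem infEDist_le_semiDist {A C : Set X} {a : X} (ha : a ∈ A) :
    Metric.infEDist a C ≤ semiDist A C :=
  le_iSup₂ (f := fun a (_ : a ∈ A) => Metric.infEDist a C) a ha

theorem semiDist_le_iff {A C : Set X} {c : ℝ≥0∞} :
    semiDist A C ≤ c ↔ ∀ a ∈ A, Metric.infEDist a C ≤ c :=
  iSup₂_le_iff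

theorem semiDist_le_of_subset_thickening {A C : Set X} {δ : ℝ}
    (h : A ⊆ Metric.thickening δ C) : semiDist A C ≤ ENNReal.ofReal δ :=
  semiDist_le_iff.2 fun _ ha => le_of_lt (h ha)

theorem subset_thickening_of_semiDist_lt {A C : Set X} {δ : ℝ}
    (h : semiDist A C < ENNReal.ofReal δ) : A ⊆ Metric.thickening δ C :=
  fun _ ha => (infEDist_le_semiDist ha).trans_lt h

theorem tendsto_zero_of_eventually_le_ofReal {ι : Type*} {l : Filter ι} {f : ι → ℝ≥0∞}
    (h : ∀ δ : ℝ, 0 < δ → ∀ᶠ i in l, f i ≤ ENNReal.ofReal δ) : Tendsto f l (𝓝 0) := by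
  refine ENNReal.tendsto_nhds_zero.2 fun ε hε => ?_
  obtain ⟨c, hc0, hcε⟩ := ENNReal.lt_iff_exists_nnreal_btwn.1 hε
  filter_upwards [h c (by exact_mod_cast hc0)] with i hi
  exact hi.trans (by simpa using hcε.le)

end SemiDist

/-! ### Attractors of a process with a compact trapping set. -/

section Attractors

variable {X : Type*} [MetricSpace X] {S : ℝ → ℝ → X → X} {K : Set X}

theorem IsProcess.continuous_map (hS : IsProcess S) {s t : ℝ} (hst : s ≤ t) :
    Continuous (S t s) :=
  hS.continuousOn.comp_continuous (f := fun x : X => ((t, s, x) : ℝ × ℝ × X))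
    (by fun_prop) fun _ => hst

/-- A compact set that is positively invariant and absorbs every bounded set, uniformly in the
initial time. -/
structure IsTrapping (S : ℝ → ℝ → X → X) (K : Set X) : Prop where
  isCompact : IsCompact K
  nonempty : K.Nonempty
  mapsTo : ∀ s t : ℝ, s ≤ t → MapsTo (S t s) K K
  absorbs : ∀ B : Set X, Bornology.IsBounded B →
    ∃ T : ℝ, 0 ≤ T ∧ ∀ s t : ℝ, s + T ≤ t → MapsTo (S t s) B K

theorem IsTrapping.image_subset (hK : IsTrapping S K) {s t : ℝ} (hst : s ≤ t) :
    S t s '' K ⊆ K :=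
  (hK.mapsTo s t hst).image_subset

/-- The states at time `t` that are reached from `K` starting at any earlier time. -/
def pullbackLimit {X : Type*} (S : ℝ → ℝ → X → X) (K : Set X) (t : ℝ) : Set X :=
  ⋂ s : Iic t, S t s '' K

/-- An earlier start passes through `K` at time `s'`. This monotonicity makes the images directed,
so that compactness arguments apply to their intersection. -/
theorem antitone_image (hS : IsProcess S) (hK : IsTrapping S K) {s s' t : ℝ} (hs : s ≤ s')
    (hs' : s' ≤ t) : S t s '' K ⊆ S t s' '' K := by
  rintro _ ⟨x, hx, rfl⟩
  exact ⟨S s' s x, hK.mapsTo _ _ hs hx, hS.comp _ _ _ hs hs' x⟩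

theorem isCompact_image (hS : IsProcess S) (hK : IsTrapping S K) {s t : ℝ} (hst : s ≤ t) :
    IsCompact (S t s '' K) :=
  hK.isCompact.image (hS.continuous_map hst)

theorem directed_image (hS : IsProcess S) (hK : IsTrapping S K) (t : ℝ) :
    Directed (· ⊇ ·) fun s : Iic t => S t s '' K := by
  intro a b
  refine ⟨⟨min a.1 b.1, mem_Iic.2 ((min_le_left _ _).trans a.2)⟩, ?_, ?_⟩
  · exact antitone_image hS hK (min_le_left _ _) a.2
  · exact antitone_image hS hK (min_le_right _ _) b.2

theorem isCompact_pullbackLimit (hS : IsProcess S) (hK : IsTrapping S K) (t : ℝ) :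
    IsCompact (pullbackLimit S K t) :=
  (isCompact_image hS hK le_rfl).of_isClosed_subset
    (isClosed_iInter fun s => (isCompact_image hS hK s.2).isClosed)
    (iInter_subset (fun s : Iic t => S t s '' K) ⟨t, self_mem_Iic⟩)

theorem nonempty_pullbackLimit (hS : IsProcess S) (hK : IsTrapping S K) (t : ℝ) :
    (pullbackLimit S K t).Nonempty :=
  IsCompact.nonempty_iInter_of_directed_nonempty_isCompact_isClosed _ (directed_image hS hK t)
    (fun _ => hK.nonempty.image _) (fun s => isCompact_image hS hK s.2)
    (fun s => (isCompact_image hS hK s.2).isClosed)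

theorem pullbackLimit_subset_image {X : Type*} {S : ℝ → ℝ → X → X} {K : Set X} {s t : ℝ} (hst : s ≤ t) :
    pullbackLimit S K t ⊆ S t s '' K :=
  iInter_subset (fun s : Iic t => S t s '' K) ⟨s, hst⟩

theorem pullbackLimit_subset (hK : IsTrapping S K) (t : ℝ) : pullbackLimit S K t ⊆ K :=
  (pullbackLimit_subset_image le_rfl).trans (hK.image_subset le_rfl)

theorem isInvariantFamily_pullbackLimit (hS : IsProcess S) (hK : IsTrapping S K) :
    IsInvariantFamily S (pullbackLimit S K) := by
  intro s t hst
  apply Subset.antisymm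
  · rintro _ ⟨x, hx, rfl⟩
    refine mem_iInter.2 fun τ => ?_
    rcases le_total τ.1 s with h | h
    · obtain ⟨y, hy, rfl⟩ := pullbackLimit_subset_image h hx
      exact ⟨y, hy, (hS.comp _ _ _ h hst y).symm⟩
    · refine antitone_image hS hK h τ.2 ⟨x, pullbackLimit_subset hK s hx, rfl⟩
  -- The parts of the fibre over `x` inside the sets `S(s,τ)K` are non-empty, compact and decreasing
  -- as `τ → -∞`; a common point is a preimage in the limit set.
  · intro x hx
    have hcl : IsClosed (S t s ⁻¹' {x}) := isClosed_singleton.preimage (hS.continuous_map hst)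
    have hc : ∀ τ : Iic s, IsCompact (S s τ '' K ∩ S t s ⁻¹' {x}) := fun τ =>
      (isCompact_image hS hK τ.2).inter_right hcl
    obtain ⟨y, hy⟩ := IsCompact.nonempty_iInter_of_directed_nonempty_isCompact_isClosed
      (fun τ : Iic s => S s τ '' K ∩ S t s ⁻¹' {x})
      (fun a b => by
        obtain ⟨c, hca, hcb⟩ := directed_image hS hK s a b
        exact ⟨c, inter_subset_inter_left _ hca, inter_subset_inter_left _ hcb⟩)
      (fun τ => by
        obtain ⟨y, hy, hyx⟩ := pullbackLimit_subset_image (le_trans τ.2 hst) hx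
        exact ⟨S s τ y, ⟨y, hy, rfl⟩, by simpa [hS.comp _ _ _ τ.2 hst] using hyx⟩)
      hc (fun τ => (hc τ).isClosed)
    have hy' := mem_iInter.1 hy
    exact ⟨y, mem_iInter.2 fun τ => (hy' τ).1, (hy' ⟨s, self_mem_Iic⟩).2⟩

theorem isPullbackAttracting_pullbackLimit (hS : IsProcess S) (hK : IsTrapping S K) :
    IsPullbackAttracting S (pullbackLimit S K) := by
  intro B hB t
  refine tendsto_zero_of_eventually_le_ofReal fun δ hδ => ?_
  have : Nonempty (Iic t) := ⟨⟨t, self_mem_Iic⟩⟩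
  -- By compactness a single image `S(t,τ)K` already lies in the thickening; orbits from `B` started
  -- early enough are in `K` at time `τ`.
  obtain ⟨τ, hτ⟩ := exists_subset_nhds_of_isCompact' (directed_image hS hK t)
    (fun s => isCompact_image hS hK s.2) (fun s => (isCompact_image hS hK s.2).isClosed)
    (U := Metric.thickening δ (pullbackLimit S K t))
    (fun x hx => Metric.isOpen_thickening.mem_nhds (Metric.self_subset_thickening hδ _ hx))
  obtain ⟨T, hT0, hT⟩ := hK.absorbs B hB
  filter_upwards [eventually_le_atBot (τ.1 - T)] with s hs
  refine semiDist_le_of_subset_thickening (Subset.trans ?_ hτ)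
  rintro _ ⟨x, hx, rfl⟩
  exact ⟨S τ s x, hT _ _ (by linarith) hx, hS.comp _ _ _ (by linarith) τ.2 x⟩

theorem isPullbackAttractor_pullbackLimit (hS : IsProcess S) (hK : IsTrapping S K) :
    IsPullbackAttractor S (pullbackLimit S K) where
  isCompact := isCompact_pullbackLimit hS hK
  invariant := isInvariantFamily_pullbackLimit hS hK
  attracting := isPullbackAttracting_pullbackLimit hS hK
  minimal C hC _ hCa t x hx := by
    -- `K` is bounded, so `C` attracts it, while `x` lies in every image of `K`.
    have h : Metric.infEDist x (C t) ≤ 0 := by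
      refine ge_of_tendsto (hCa K hK.isCompact.isBounded t) ?_
      filter_upwards [eventually_le_atBot t] with s hs
      exact infEDist_le_semiDist (pullbackLimit_subset_image hs hx)
    exact (Metric.mem_iff_infEDist_zero_of_closed (hC t).isClosed).2 (le_antisymm h bot_le)

/-- The closure of the set of states that are reached from `K` after the time `h`. -/
def reachSet (S : ℝ → ℝ → X → X) (K : Set X) (h : ℝ) : Set X :=
  closure (⋃ s : ℝ, S (s + h) s '' K)

/-- The states that are limits of states reached from `K` after arbitrarily long times. -/
def uniformLimit (S : ℝ → ℝ → X → X) (K : Set X) : Set X :=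
  ⋂ h : Ici (0 : ℝ), reachSet S K h

theorem reachSet_subset (hK : IsTrapping S K) {h : ℝ} (hh : 0 ≤ h) : reachSet S K h ⊆ K :=
  closure_minimal (iUnion_subset fun _ => hK.image_subset (by linarith)) hK.isCompact.isClosed

theorem image_subset_reachSet {s t h : ℝ} (ht : t = s + h) : S t s '' K ⊆ reachSet S K h := by
  subst ht
  exact (subset_iUnion (fun s : ℝ => S (s + h) s '' K) s).trans subset_closure

theorem isCompact_reachSet (hK : IsTrapping S K) {h : ℝ} (hh : 0 ≤ h) :
    IsCompact (reachSet S K h) :=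
  hK.isCompact.of_isClosed_subset isClosed_closure (reachSet_subset hK hh)

theorem reachSet_antitone (hS : IsProcess S) (hK : IsTrapping S K) {h h' : ℝ} (h0 : 0 ≤ h)
    (hh : h ≤ h') : reachSet S K h' ⊆ reachSet S K h := by
  refine closure_minimal (iUnion_subset fun s => ?_) isClosed_closure
  -- The new starting time leaves exactly the time `h` to run.
  refine (antitone_image hS hK (s' := s + h' - h) (by linarith) (by linarith)).trans ?_
  exact image_subset_reachSet (by ring)

theorem directed_reachSet (hS : IsProcess S) (hK : IsTrapping S K) :
    Directed (· ⊇ ·) fun h : Ici (0 : ℝ) => reachSet S K h := by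
  intro a b
  exact ⟨⟨max a.1 b.1, mem_Ici.2 (le_max_of_le_left a.2)⟩, reachSet_antitone hS hK a.2 (le_max_left _ _),
    reachSet_antitone hS hK b.2 (le_max_right _ _)⟩

theorem uniformLimit_subset_reachSet {h : ℝ} (hh : 0 ≤ h) :
    uniformLimit S K ⊆ reachSet S K h :=
  iInter_subset (fun h : Ici (0 : ℝ) => reachSet S K h) ⟨h, hh⟩

theorem isCompact_uniformLimit (hK : IsTrapping S K) : IsCompact (uniformLimit S K) :=
  (isCompact_reachSet hK le_rfl).of_isClosed_subset (isClosed_iInter fun _ => isClosed_closure)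
    (iInter_subset (fun h : Ici (0 : ℝ) => reachSet S K h) ⟨0, self_mem_Ici⟩)

theorem nonempty_uniformLimit (hS : IsProcess S) (hK : IsTrapping S K) :
    (uniformLimit S K).Nonempty :=
  IsCompact.nonempty_iInter_of_directed_nonempty_isCompact_isClosed _ (directed_reachSet hS hK)
    (fun _ => ((hK.nonempty.image _).mono (image_subset_reachSet (s := 0) rfl)))
    (fun h => isCompact_reachSet hK h.2) (fun _ => isClosed_closure)

theorem isUniformlyAttracting_uniformLimit (hS : IsProcess S) (hK : IsTrapping S K) :
    IsUniformlyAttracting S (uniformLimit S K) := by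
  intro B hB
  refine tendsto_zero_of_eventually_le_ofReal fun δ hδ => ?_
  obtain ⟨h, hh⟩ := exists_subset_nhds_of_isCompact' (directed_reachSet hS hK)
    (fun h => isCompact_reachSet hK h.2) (fun _ => isClosed_closure)
    (U := Metric.thickening δ (uniformLimit S K))
    (fun x hx => Metric.isOpen_thickening.mem_nhds (Metric.self_subset_thickening hδ _ hx))
  obtain ⟨T, hT0, hT⟩ := hK.absorbs B hB
  have h0 : (0 : ℝ) ≤ h := h.2
  filter_upwards [eventually_ge_atTop (T + h)] with t ht
  refine iSup_le fun s => semiDist_le_of_subset_thickening (Subset.trans ?_ hh)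
  rintro _ ⟨x, hx, rfl⟩
  refine image_subset_reachSet (s := t + s - h) (by ring)
    ⟨S (t + s - h) s x, hT _ _ (by linarith) hx, hS.comp _ _ _ (by linarith) (by linarith) x⟩

theorem isUniformAttractor_uniformLimit (hS : IsProcess S) (hK : IsTrapping S K) :
    IsUniformAttractor S (uniformLimit S K) where
  isCompact := isCompact_uniformLimit hK
  attracting := isUniformlyAttracting_uniformLimit hS hK
  minimal C hC hCa x hx := by
    have h : Metric.infEDist x C ≤ 0 := by
      refine ge_of_tendsto (hCa K hK.isCompact.isBounded) ?_
      filter_upwards [eventually_ge_atTop 0] with h hh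
      -- A sublevel set of the distance to `C` is closed, so the bound survives the closure in
      -- `reachSet`.
      have hsub : reachSet S K h ⊆
          {y | Metric.infEDist y C ≤ ⨆ s : ℝ, semiDist (S (h + s) s '' K) C} := by
        refine closure_minimal (iUnion_subset fun s y hy => ?_)
          (isClosed_le Metric.continuous_infEDist continuous_const)
        rw [add_comm] at hy
        exact (infEDist_le_semiDist hy).trans
          (le_iSup (fun s : ℝ => semiDist (S (h + s) s '' K) C) s)
      exact hsub (uniformLimit_subset_reachSet hh hx)
    exact (Metric.mem_iff_infEDist_zero_of_closed hC.isClosed).2 (le_antisymm h bot_le)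

end Attractors

/-! ### Generic continuity of upper semicontinuous set-valued maps. -/

section Generic

variable {P X : Type*} [TopologicalSpace P] [MetricSpace X]

/-- If the compact set `Φ p` misses `F`, so does a thickening of it, and nearby values lie in that
thickening. -/
theorem isClosed_setOf_inter_nonempty {Φ : P → Set X} (hc : ∀ p, IsCompact (Φ p))
    (husc : ∀ p, ∀ ε > 0, ∀ᶠ q in 𝓝 p, Φ q ⊆ Metric.thickening ε (Φ p)) {F : Set X}
    (hF : IsClosed F) : IsClosed {p | (Φ p ∩ F).Nonempty} := by
  refine isOpen_compl_iff.1 (isOpen_iff_mem_nhds.2 fun p hp => ?_)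
  have hsub : Φ p ⊆ Fᶜ := fun x hx hxF => hp ⟨x, hx, hxF⟩
  obtain ⟨δ, hδ, hδF⟩ := (hc p).exists_thickening_subset_open hF.isOpen_compl hsub
  filter_upwards [husc p δ hδ] with q hq
  rintro ⟨x, hx, hxF⟩
  exact hδF (hq hx) hxF

/-- An upper semicontinuous compact-valued map is lower semicontinuous on a residual set. -/
theorem exists_residual_lower_semicontinuous [SecondCountableTopology X] {Φ : P → Set X}
    (hc : ∀ p, IsCompact (Φ p))
    (husc : ∀ p, ∀ ε > 0, ∀ᶠ q in 𝓝 p, Φ q ⊆ Metric.thickening ε (Φ p)) :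
    ∃ L ∈ residual P, ∀ p ∈ L, ∀ ε > 0, ∀ᶠ q in 𝓝 p, Φ p ⊆ Metric.thickening ε (Φ q) := by
  obtain ⟨D, hDc, hD⟩ := TopologicalSpace.exists_countable_dense X
  have := hDc.to_subtype
  let F : D × ℕ → Set P := fun i => {p | (Φ p ∩ Metric.closedBall i.1 (1 / (i.2 + 1))).Nonempty}
  have hF : ∀ i, IsClosed (F i) := fun i =>
    isClosed_setOf_inter_nonempty hc husc Metric.isClosed_closedBall
  -- The frontier of a closed set is closed and nowhere dense. Off all frontiers, whenever `Φ p`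
  -- meets one of the countably many balls, so does `Φ q` for `q` near `p`; compactness of `Φ p`
  -- reduces the claim to finitely many balls.
  refine ⟨⋂ i, (frontier (F i))ᶜ, countable_iInter_mem.2 fun i =>
    residual_of_dense_open isClosed_frontier.isOpen_compl
      (interior_eq_empty_iff_dense_compl.1 (interior_frontier (hF i))), fun p hp ε hε => ?_⟩
  refine (hc p).induction_on (p := fun T => ∀ᶠ q in 𝓝 p, T ⊆ Metric.thickening ε (Φ q))
    (by simp) (fun s t hst ht => ht.mono fun q hq => hst.trans hq)
    (fun s t hs ht => by filter_upwards [hs, ht] with q h1 h2 using union_subset h1 h2)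
    fun a ha => ?_
  obtain ⟨k, hk⟩ := exists_nat_one_div_lt (show 0 < ε / 4 by positivity)
  obtain ⟨x, hxD, hx⟩ := hD.exists_dist_lt a (show (0 : ℝ) < 1 / (k + 1) by positivity)
  have hpF : p ∈ F (⟨x, hxD⟩, k) := ⟨a, ha, hx.le⟩
  have hint : p ∈ interior (F (⟨x, hxD⟩, k)) := by
    by_contra hni
    exact mem_iInter.1 hp (⟨x, hxD⟩, k) ⟨subset_closure hpF, hni⟩
  refine ⟨Metric.ball a (ε / 4), mem_nhdsWithin_of_mem_nhds (Metric.ball_mem_nhds _ (by positivity)),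
    ?_⟩
  filter_upwards [mem_interior_iff_mem_nhds.1 hint] with q hq z hz
  obtain ⟨y, hy, hyx⟩ := hq
  refine Metric.mem_thickening_iff.2 ⟨y, hy, ?_⟩
  have h1 : dist z a < ε / 4 := hz
  have h2 : dist y x ≤ 1 / ((k : ℝ) + 1) := hyx
  have h3 := dist_triangle4 z a x y
  rw [dist_comm x y] at h3
  linarith

theorem continuousAt_nonemptyCompacts {Φ : P → TopologicalSpace.NonemptyCompacts X} {p : P}
    (husc : ∀ ε > 0, ∀ᶠ q in 𝓝 p, (Φ q : Set X) ⊆ Metric.thickening ε (Φ p))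
    (hlsc : ∀ ε > 0, ∀ᶠ q in 𝓝 p, (Φ p : Set X) ⊆ Metric.thickening ε (Φ q)) :
    ContinuousAt Φ p := by
  refine Metric.tendsto_nhds.2 fun ε hε => ?_
  filter_upwards [husc (ε / 2) (half_pos hε), hlsc (ε / 2) (half_pos hε)] with q h1 h2
  rw [Metric.NonemptyCompacts.dist_eq]
  refine lt_of_le_of_lt (Metric.hausdorffDist_le_of_mem_dist (half_pos hε).le ?_ ?_)
    (half_lt_self hε)
  · intro x hx
    obtain ⟨y, hy, hxy⟩ := Metric.mem_thickening_iff.1 (h1 hx)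
    exact ⟨y, hy, hxy.le⟩
  · intro x hx
    obtain ⟨y, hy, hxy⟩ := Metric.mem_thickening_iff.1 (h2 hx)
    exact ⟨y, hy, hxy.le⟩

end Generic

/-! ### Semicontinuity of attractors in a parameter. -/

section Family

variable {P X : Type*} [TopologicalSpace P] [MetricSpace X] {S : P → ℝ → ℝ → X → X}
  {K : P → Set X}

/-- A parametrised family of processes with locally uniformly bounded trapping sets that depends
continuously on the parameter, uniformly in the initial time and for bounded initial states. -/
structure IsContinuousFamily (S : P → ℝ → ℝ → X → X) (K : P → Set X) : Prop where
  process : ∀ p, IsProcess (S p)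
  isTrapping : ∀ p, IsTrapping (S p) (K p)
  locallyBounded : ∀ p, ∃ B : Set X, Bornology.IsBounded B ∧ ∀ᶠ q in 𝓝 p, K q ⊆ B
  continuous : ∀ p, ∀ B : Set X, Bornology.IsBounded B → ∀ h : ℝ, 0 ≤ h → ∀ ε : ℝ, 0 < ε →
    ∀ᶠ q in 𝓝 p, ∀ s : ℝ, ∀ x ∈ B, dist (S q (s + h) s x) (S p (s + h) s x) < ε

theorem mem_thickening_of_dist_lt {A : Set X} {x y : X} {δ ε : ℝ} (hxy : dist x y < δ)
    (hy : y ∈ Metric.thickening ε A) : x ∈ Metric.thickening (δ + ε) A := by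
  obtain ⟨z, hz, hyz⟩ := Metric.mem_thickening_iff.1 hy
  exact Metric.mem_thickening_iff.2 ⟨z, hz, (dist_triangle x y z).trans_lt (add_lt_add hxy hyz)⟩

/-- One starting time `s` suffices: the set for `q` lies in `S_q(t,s)B`, which is uniformly close to
`S_p(t,s)B`, which is close to the set for `p`. -/
theorem IsContinuousFamily.pullback_upper (h : IsContinuousFamily S K) (t : ℝ) (p : P) (ε : ℝ)
    (hε : 0 < ε) : ∀ᶠ q in 𝓝 p,
      pullbackLimit (S q) (K q) t ⊆ Metric.thickening ε (pullbackLimit (S p) (K p) t) := by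
  obtain ⟨B, hB, hKB⟩ := h.locallyBounded p
  have hatt := isPullbackAttracting_pullbackLimit (h.process p) (h.isTrapping p) B hB t
  obtain ⟨s, hs, hst⟩ := ((hatt.eventually_lt_const
    (ENNReal.ofReal_pos.2 (half_pos hε))).and (eventually_le_atBot t)).exists
  filter_upwards [hKB, h.continuous p B hB (t - s) (by linarith) (ε / 2) (half_pos hε)]
    with q hq hqc x hx
  obtain ⟨y, hy, rfl⟩ := pullbackLimit_subset_image hst hx
  have hd := hqc s y (hq hy)
  rw [add_sub_cancel] at hd
  have := mem_thickening_of_dist_lt hd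
    (subset_thickening_of_semiDist_lt hs (mem_image_of_mem _ (hq hy)))
  rwa [add_halves] at this

theorem IsContinuousFamily.uniform_upper (h : IsContinuousFamily S K) (p : P) (ε : ℝ)
    (hε : 0 < ε) : ∀ᶠ q in 𝓝 p,
      uniformLimit (S q) (K q) ⊆ Metric.thickening ε (uniformLimit (S p) (K p)) := by
  obtain ⟨B, hB, hKB⟩ := h.locallyBounded p
  -- Two errors of `ε/4` add up to `ε/2`; the rest leaves room for the closure in `reachSet`.
  have hε4 : 0 < ε / 4 := by positivity
  have hatt := isUniformlyAttracting_uniformLimit (h.process p) (h.isTrapping p) B hB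
  obtain ⟨T, hT, hT0⟩ := ((hatt.eventually_lt_const
    (ENNReal.ofReal_pos.2 hε4)).and (eventually_ge_atTop 0)).exists
  filter_upwards [hKB, h.continuous p B hB T hT0 (ε / 4) hε4] with q hq hqc
  have hsub : (⋃ s : ℝ, S q (s + T) s '' K q) ⊆
      Metric.thickening (ε / 2) (uniformLimit (S p) (K p)) := by
    refine iUnion_subset fun s => ?_
    rintro _ ⟨y, hy, rfl⟩
    have hlt := (le_iSup (fun s : ℝ => semiDist (S p (T + s) s '' B)
      (uniformLimit (S p) (K p))) s).trans_lt hT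
    have hlt' := subset_thickening_of_semiDist_lt hlt (mem_image_of_mem _ (hq hy))
    rw [add_comm T s] at hlt'
    have := mem_thickening_of_dist_lt (hqc s y (hq hy)) hlt'
    rwa [show ε / 4 + ε / 4 = ε / 2 by ring] at this
  exact (uniformLimit_subset_reachSet hT0).trans <| (closure_mono hsub).trans <|
    (Metric.closure_thickening_subset_cthickening _ _).trans <|
    Metric.cthickening_subset_thickening' hε (half_lt_self hε) _

/-- Lower semicontinuity of the pullback limit sets propagates forward in time. -/
theorem IsContinuousFamily.pullback_lower_of_le [ProperSpace X] (h : IsContinuousFamily S K)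
    {n t : ℝ} (hnt : n ≤ t) {p : P}
    (hn : ∀ ε > 0, ∀ᶠ q in 𝓝 p,
      pullbackLimit (S p) (K p) n ⊆ Metric.thickening ε (pullbackLimit (S q) (K q) n))
    (ε : ℝ) (hε : 0 < ε) : ∀ᶠ q in 𝓝 p,
      pullbackLimit (S p) (K p) t ⊆ Metric.thickening ε (pullbackLimit (S q) (K q) t) := by
  obtain ⟨B, hB, hKB⟩ := h.locallyBounded p
  have hpB : K p ⊆ B := hKB.self_of_nhds
  have huc := (hB.isCompact_closure).uniformContinuousOn_of_continuous
    ((h.process p).continuous_map hnt).continuousOn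
  obtain ⟨δ, hδ, hδε⟩ := Metric.uniformContinuousOn_iff.1 huc (ε / 2) (half_pos hε)
  filter_upwards [hKB, hn δ hδ, h.continuous p B hB (t - n) (by linarith) (ε / 2) (half_pos hε)]
    with q hq hqn hqc x hx
  rw [← isInvariantFamily_pullbackLimit (h.process p) (h.isTrapping p) n t hnt] at hx
  obtain ⟨a, ha, rfl⟩ := hx
  obtain ⟨b, hb, hab⟩ := Metric.mem_thickening_iff.1 (hqn ha)
  have haB : a ∈ B := hpB (pullbackLimit_subset (h.isTrapping p) n ha)
  have hbB : b ∈ B := hq (pullbackLimit_subset (h.isTrapping q) n hb)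
  have h1 := hδε a (subset_closure haB) b (subset_closure hbB) hab
  have h2 := hqc n b hbB
  rw [add_sub_cancel, dist_comm] at h2
  refine Metric.mem_thickening_iff.2 ⟨S q t n b, ?_, ?_⟩
  · rw [← isInvariantFamily_pullbackLimit (h.process q) (h.isTrapping q) n t hnt]
    exact mem_image_of_mem _ hb
  · exact (dist_triangle _ (S p t n b) _).trans_lt (by linarith)

/-- The attractors of a continuous family of processes exist and depend continuously on the
parameter on a residual set. -/
theorem IsContinuousFamily.exists_attractors [ProperSpace X] (h : IsContinuousFamily S K) :
    ∃ (A : P → ℝ → TopologicalSpace.NonemptyCompacts X)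
      (U : P → TopologicalSpace.NonemptyCompacts X),
      (∀ p, IsPullbackAttractor (S p) (fun t => (A p t : Set X)) ∧
        IsUniformAttractor (S p) (U p : Set X)) ∧
      ∃ L ∈ residual P, ∀ p ∈ L,
        (∀ t : ℝ, ContinuousAt (fun q => A q t) p) ∧ ContinuousAt U p := by
  refine ⟨fun p t => ⟨⟨pullbackLimit (S p) (K p) t,
      isCompact_pullbackLimit (h.process p) (h.isTrapping p) t⟩,
      nonempty_pullbackLimit (h.process p) (h.isTrapping p) t⟩,
    fun p => ⟨⟨uniformLimit (S p) (K p), isCompact_uniformLimit (h.isTrapping p)⟩,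
      nonempty_uniformLimit (h.process p) (h.isTrapping p)⟩,
    fun p => ⟨isPullbackAttractor_pullbackLimit (h.process p) (h.isTrapping p),
      isUniformAttractor_uniformLimit (h.process p) (h.isTrapping p)⟩, ?_⟩
  -- Only countably many residual sets may be intersected, hence integer times; a real `t` is
  -- reached from `⌊t⌋`.
  choose LA hLA hLA' using fun n : ℤ => exists_residual_lower_semicontinuous
    (fun p => isCompact_pullbackLimit (h.process p) (h.isTrapping p) n) (h.pullback_upper n)
  obtain ⟨LU, hLU, hLU'⟩ := exists_residual_lower_semicontinuous
    (fun p => isCompact_uniformLimit (h.isTrapping p)) h.uniform_upper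
  refine ⟨(⋂ n, LA n) ∩ LU, inter_mem (countable_iInter_mem.2 hLA) hLU,
    fun p hp => ⟨fun t => ?_, ?_⟩⟩
  · exact continuousAt_nonemptyCompacts (h.pullback_upper t p)
      (h.pullback_lower_of_le (Int.floor_le t) (hLA' _ p (mem_iInter.1 hp.1 ⌊t⌋)))
  · exact continuousAt_nonemptyCompacts (h.uniform_upper p) (hLU' p hp.2)

end Family

/-! ### Local Lipschitz estimates for the Lorenz field. -/

section Field

theorem abs_apply_le_norm (v : E3) (i : Fin 3) : |v i| ≤ ‖v‖ :=
  PiLp.norm_apply_le v i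

theorem norm_sq_eq_sum (v : E3) : ‖v‖ ^ 2 = v 0 ^ 2 + v 1 ^ 2 + v 2 ^ 2 := by
  rw [EuclideanSpace.norm_sq_eq, Fin.sum_univ_three]
  simp

theorem norm_le_sum_abs (v : E3) : ‖v‖ ≤ |v 0| + |v 1| + |v 2| := by
  refine abs_le_of_sq_le_sq' ?_ (by positivity) |>.2
  rw [norm_sq_eq_sum, ← sq_abs (v 0), ← sq_abs (v 1), ← sq_abs (v 2)]
  nlinarith [mul_nonneg (abs_nonneg (v 0)) (abs_nonneg (v 1)),
    mul_nonneg (abs_nonneg (v 0)) (abs_nonneg (v 2)),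
    mul_nonneg (abs_nonneg (v 1)) (abs_nonneg (v 2))]

@[simp] theorem lorenzField_zero (r : ℝ → ℝ) (σ b t : ℝ) (v : E3) :
    lorenzField r σ b t v 0 = -σ * v 0 + σ * v 1 := rfl

@[simp] theorem lorenzField_one (r : ℝ → ℝ) (σ b t : ℝ) (v : E3) :
    lorenzField r σ b t v 1 = r t * v 0 - v 1 - v 0 * v 2 := rfl

@[simp] theorem lorenzField_two (r : ℝ → ℝ) (σ b t : ℝ) (v : E3) :
    lorenzField r σ b t v 2 = -b * v 2 + v 0 * v 1 := rfl

/-- One factor is bounded from each product, so that below only the unprimed parameters need bounds.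
-/
theorem abs_mul_sub_mul_le {a b c d M N : ℝ} (ha : |a| ≤ M) (hd : |d| ≤ N) :
    |a * b - c * d| ≤ M * |b - d| + N * |a - c| := by
  have h : a * b - c * d = a * (b - d) + d * (a - c) := by ring
  rw [h]
  refine (abs_add_le _ _).trans ?_
  rw [abs_mul, abs_mul]
  gcongr

/-- Lipschitz estimate for the Lorenz field on a box, jointly in the state and the parameters. -/
theorem norm_lorenzField_sub_le {r r' : ℝ → ℝ} {σ σ' b b' t N R η : ℝ} {v w : E3}
    (hσ : |σ| ≤ N) (hb : |b| ≤ N) (hr : |r t| ≤ N) (hη : |r t - r' t| ≤ η)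
    (hv : ∀ i, |v i| ≤ R) (hw : ∀ i, |w i| ≤ R) :
    ‖lorenzField r σ b t v - lorenzField r' σ' b' t w‖ ≤
      (4 * N + 1 + 4 * R) * ‖v - w‖ + R * (2 * |σ - σ'| + η + |b - b'|) := by
  have hN : 0 ≤ N := (abs_nonneg _).trans hσ
  have hR : 0 ≤ R := (abs_nonneg _).trans (hv 0)
  have hd : ∀ i, |v i - w i| ≤ ‖v - w‖ := fun i => abs_apply_le_norm (v - w) i
  have e0 := abs_mul_sub_mul_le (b := v 0) (c := σ') hσ (hw 0)
  have e1 := abs_mul_sub_mul_le (b := v 1) (c := σ') hσ (hw 1)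
  have e2 := abs_mul_sub_mul_le (b := v 0) (c := r' t) hr (hw 0)
  have e3 := abs_mul_sub_mul_le (b := v 2) (c := w 0) (hv 0) (hw 2)
  have e4 := abs_mul_sub_mul_le (b := v 2) (c := b') hb (hw 2)
  have e5 := abs_mul_sub_mul_le (b := v 1) (c := w 0) (hv 0) (hw 1)
  have h0 := hd 0
  have h1 := hd 1
  have h2 := hd 2
  set d := ‖v - w‖
  have f0 := mul_le_mul_of_nonneg_left h0 hN
  have f1 := mul_le_mul_of_nonneg_left h1 hN
  have f2 := mul_le_mul_of_nonneg_left h2 hN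
  have g0 := mul_le_mul_of_nonneg_left h0 hR
  have g1 := mul_le_mul_of_nonneg_left h1 hR
  have g2 := mul_le_mul_of_nonneg_left h2 hR
  have gη := mul_le_mul_of_nonneg_left hη hR
  refine (norm_le_sum_abs _).trans ?_
  simp only [PiLp.sub_apply, lorenzField_zero, lorenzField_one, lorenzField_two]
  have k0 : |-σ * v 0 + σ * v 1 - (-σ' * w 0 + σ' * w 1)| ≤
      |σ * v 0 - σ' * w 0| + |σ * v 1 - σ' * w 1| := by
    rw [show -σ * v 0 + σ * v 1 - (-σ' * w 0 + σ' * w 1) =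
      -(σ * v 0 - σ' * w 0) + (σ * v 1 - σ' * w 1) by ring]
    exact (abs_add_le _ _).trans (by rw [abs_neg])
  have k1 : |r t * v 0 - v 1 - v 0 * v 2 - (r' t * w 0 - w 1 - w 0 * w 2)| ≤
      |r t * v 0 - r' t * w 0| + |v 1 - w 1| + |v 0 * v 2 - w 0 * w 2| := by
    rw [show r t * v 0 - v 1 - v 0 * v 2 - (r' t * w 0 - w 1 - w 0 * w 2) =
      (r t * v 0 - r' t * w 0) - (v 1 - w 1) - (v 0 * v 2 - w 0 * w 2) by ring]
    exact (abs_sub _ _).trans (add_le_add_left (abs_sub _ _) _)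
  have k2 : |-b * v 2 + v 0 * v 1 - (-b' * w 2 + w 0 * w 1)| ≤
      |b * v 2 - b' * w 2| + |v 0 * v 1 - w 0 * w 1| := by
    rw [show -b * v 2 + v 0 * v 1 - (-b' * w 2 + w 0 * w 1) =
      -(b * v 2 - b' * w 2) + (v 0 * v 1 - w 0 * w 1) by ring]
    exact (abs_add_le _ _).trans (by rw [abs_neg])
  linarith

end Field

/-! ### The Lyapunov function and dissipativity. -/

section Energy

/-- A Lyapunov function for the Lorenz system with forcing bounded by `√β`. -/
noncomputable def lorenzEnergy (β σ : ℝ) (v : E3) : ℝ :=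
  β / σ * v 0 ^ 2 + v 1 ^ 2 + (v 2 - β) ^ 2

theorem continuous_lorenzEnergy (β σ : ℝ) : Continuous (lorenzEnergy β σ) := by
  unfold lorenzEnergy
  fun_prop

/-- The derivative of the Lyapunov function in direction `w`. -/
noncomputable def lorenzEnergyDeriv (β σ : ℝ) (v w : E3) : ℝ :=
  β / σ * (2 * v 0 * w 0) + 2 * v 1 * w 1 + 2 * (v 2 - β) * w 2

theorem hasDerivWithinAt_apply {v : ℝ → E3} {w : E3} {s : Set ℝ} {t : ℝ}
    (h : HasDerivWithinAt v w s t) (i : Fin 3) :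
    HasDerivWithinAt (fun τ => v τ i) (w i) s t :=
  (EuclideanSpace.proj (𝕜 := ℝ) i).hasFDerivAt.comp_hasDerivWithinAt t h

theorem hasDerivWithinAt_lorenzEnergy {β σ : ℝ} {v : ℝ → E3} {w : E3} {s : Set ℝ} {t : ℝ}
    (h : HasDerivWithinAt v w s t) :
    HasDerivWithinAt (fun τ => lorenzEnergy β σ (v τ)) (lorenzEnergyDeriv β σ (v t) w) s t := by
  have h0 := ((hasDerivWithinAt_apply h 0).pow 2).const_mul (β / σ)
  have h1 := (hasDerivWithinAt_apply h 1).pow 2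
  have h2 := ((hasDerivWithinAt_apply h 2).sub_const β).pow 2
  refine ((h0.add h1).add h2).congr_deriv ?_
  simp only [lorenzEnergyDeriv]
  norm_num

/-- Dissipativity of the Lorenz system. -/
theorem lorenzEnergyDeriv_le {r : ℝ → ℝ} {β σ b k t : ℝ} (hβ : 1 ≤ β) (hσ : 0 < σ) (hb : 0 ≤ b)
    (hkσ : k ≤ σ) (hkb : k ≤ b) (hk1 : k ≤ 1) (hr : r t ^ 2 ≤ β) (v : E3) :
    lorenzEnergyDeriv β σ v (lorenzField r σ b t v) ≤
      -k * lorenzEnergy β σ v + b * β ^ 2 := by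
  simp only [lorenzEnergyDeriv, lorenzEnergy, lorenzField_zero, lorenzField_one, lorenzField_two]
  have e : β / σ * (2 * v 0 * (-σ * v 0 + σ * v 1)) = -2 * β * v 0 ^ 2 + 2 * β * v 0 * v 1 := by
    field_simp
  have e' : k * (β / σ * v 0 ^ 2) ≤ β * v 0 ^ 2 := by
    have : k * (β / σ * v 0 ^ 2) = (k / σ) * (β * v 0 ^ 2) := by ring
    rw [this]
    exact mul_le_of_le_one_left (by positivity) ((div_le_one hσ).2 hkσ)
  rw [e]
  -- The terms in `xyz` and `βxy` cancel. What remains is controlled by `2rxy ≤ r²x² + y² ≤ βx² +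
  -- y²` and `-2bz² + 2bβz = -bz² - b(z - β)² + bβ²`.
  nlinarith [sq_nonneg (r t * v 0 - v 1), mul_nonneg (sub_nonneg.2 hr) (sq_nonneg (v 0)),
    mul_nonneg (sub_nonneg.2 hk1) (sq_nonneg (v 1)),
    mul_nonneg (sub_nonneg.2 hkb) (sq_nonneg (v 2 - β)), mul_nonneg hb (sq_nonneg (v 2))]

theorem norm_sq_le_lorenzEnergy {β σ N : ℝ} (hβ : 1 ≤ β) (hσ : 0 < σ) (hN : σ ≤ N) (v : E3) :
    ‖v‖ ^ 2 ≤ (N + 3) * lorenzEnergy β σ v + 2 * β ^ 2 := by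
  have h0 : v 0 ^ 2 ≤ N * (β / σ * v 0 ^ 2) := by
    have h : N * (β / σ * v 0 ^ 2) = (N / σ) * (β * v 0 ^ 2) := by ring
    have h1 : 1 ≤ N / σ := (one_le_div hσ).2 hN
    rw [h]
    nlinarith [sq_nonneg (v 0), mul_nonneg (sub_nonneg.2 hβ) (sq_nonneg (v 0)),
      mul_nonneg (sub_nonneg.2 h1) (mul_nonneg (zero_le_one.trans hβ) (sq_nonneg (v 0)))]
  have h1 : 0 ≤ β / σ * v 0 ^ 2 := by positivity
  rw [norm_sq_eq_sum]
  unfold lorenzEnergy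
  -- The first square is `z² ≤ 2(z - β)² + 2β²`.
  nlinarith [sq_nonneg (v 2 - 2 * β), mul_nonneg (hσ.le.trans hN) (sq_nonneg (v 1)),
    mul_nonneg (hσ.le.trans hN) (sq_nonneg (v 2 - β)), sq_nonneg (v 1), sq_nonneg (v 2 - β)]

theorem lorenzEnergy_le {β σ m : ℝ} (hβ : 0 ≤ β) (hm : 0 < m) (hσ : m ≤ σ) (v : E3) :
    lorenzEnergy β σ v ≤ (β / m + 3) * ‖v‖ ^ 2 + 2 * β ^ 2 := by
  have h0 : β / σ * v 0 ^ 2 ≤ β / m * v 0 ^ 2 := by gcongr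
  have h1 : 0 ≤ β / m := by positivity
  rw [norm_sq_eq_sum]
  unfold lorenzEnergy
  nlinarith [sq_nonneg (v 2 + β), sq_nonneg (v 0), sq_nonneg (v 1), sq_nonneg (v 2),
    mul_nonneg h1 (sq_nonneg (v 1)), mul_nonneg h1 (sq_nonneg (v 2))]

/-- A bound for the coordinates of the states of energy at most `c`. -/
noncomputable def energyRadius (β N c : ℝ) : ℝ :=
  √((N + 3) * c + 2 * β ^ 2)

theorem norm_le_energyRadius {β σ N c : ℝ} (hβ : 1 ≤ β) (hσ : 0 < σ) (hN : σ ≤ N) {v : E3}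
    (hv : lorenzEnergy β σ v ≤ c) : ‖v‖ ≤ energyRadius β N c := by
  refine Real.le_sqrt_of_sq_le ((norm_sq_le_lorenzEnergy hβ hσ hN v).trans ?_)
  have : 0 ≤ N + 3 := by linarith
  gcongr

end Energy

/-! ### Grönwall estimates for solutions. -/

section Solutions

/-- `v` solves the Lorenz system on `[s,T]`, with right derivatives. -/
structure IsLorenzSolutionOn (r : ℝ → ℝ) (σ b s T : ℝ) (v : ℝ → E3) : Prop where
  continuousOn : ContinuousOn v (Icc s T)
  hasDerivWithinAt : ∀ t ∈ Ico s T, HasDerivWithinAt v (lorenzField r σ b t (v t)) (Ici t) t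

variable {r r' : ℝ → ℝ} {σ σ' b b' s T β : ℝ} {v w : ℝ → E3}

theorem IsLorenzSolution.continuousOn (h : IsLorenzSolution r σ b s v) :
    ContinuousOn v (Ici s) :=
  fun t ht => (h t ht).continuousWithinAt

theorem IsLorenzSolution.on (h : IsLorenzSolution r σ b s v) (T : ℝ) :
    IsLorenzSolutionOn r σ b s T v where
  continuousOn := h.continuousOn.mono Icc_subset_Ici_self
  hasDerivWithinAt t ht := (h t ht.1).mono (Ici_subset_Ici.2 ht.1)

theorem IsLorenzSolution.mono (h : IsLorenzSolution r σ b s v) {τ : ℝ} (hτ : s ≤ τ) :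
    IsLorenzSolution r σ b τ v :=
  fun t ht => (h t (le_trans hτ ht)).mono (Ici_subset_Ici.2 hτ)

theorem IsLorenzSolution.congr (h : IsLorenzSolution r σ b s v) (hw : EqOn w v (Ici s)) :
    IsLorenzSolution r σ b s w := by
  intro t ht
  rw [hw ht]
  exact (h t ht).congr hw (hw ht)

/-- Solutions with different initial times become solutions from time `0` with different forcings,
which the Grönwall estimate can compare. -/
theorem IsLorenzSolution.shift (h : IsLorenzSolution r σ b s v) :
    IsLorenzSolution (fun τ => r (s + τ)) σ b 0 (fun τ => v (s + τ)) := by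
  intro t ht
  have ht' : s + t ∈ Ici s := by simpa using ht
  have hd : HasDerivWithinAt (fun τ : ℝ => s + τ) 1 (Ici 0) t :=
    ((hasDerivAt_id t).const_add s).hasDerivWithinAt
  have := (h (s + t) ht').scomp t hd (fun τ hτ => by simpa using hτ)
  rw [one_smul] at this
  exact this

theorem IsLorenzSolutionOn.mono (h : IsLorenzSolutionOn r σ b s T v) {T' : ℝ} (hT : T' ≤ T) :
    IsLorenzSolutionOn r σ b s T' v where
  continuousOn := h.continuousOn.mono (Icc_subset_Icc_right hT)
  hasDerivWithinAt t ht := h.hasDerivWithinAt t ⟨ht.1, ht.2.trans_le hT⟩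

theorem gronwallBound_le {δ κ ε x : ℝ} (hκ : 1 ≤ κ) (hε : 0 ≤ ε) (hx : 0 ≤ x) :
    gronwallBound δ κ ε x ≤ (δ + ε) * Real.exp (κ * x) := by
  have h0 : 0 < κ := by linarith
  rw [gronwallBound_of_K_ne_0 h0.ne']
  have h1 : ε / κ ≤ ε := div_le_self hε hκ
  have h2 : 0 ≤ Real.exp (κ * x) - 1 := by
    have := Real.add_one_le_exp (κ * x)
    have := mul_nonneg h0.le hx
    linarith
  nlinarith [mul_le_mul_of_nonneg_right h1 h2]

/-- Continuous dependence of bounded solutions on the initial state and the parameters. -/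
theorem dist_le_of_isLorenzSolutionOn {N R η : ℝ}
    (hv : IsLorenzSolutionOn r σ b s T v) (hw : IsLorenzSolutionOn r' σ' b' s T w)
    (hσ : |σ| ≤ N) (hb : |b| ≤ N) (hr : ∀ t, |r t| ≤ N) (hη : ∀ t, |r t - r' t| ≤ η)
    (hvR : ∀ t ∈ Icc s T, ∀ i, |v t i| ≤ R) (hwR : ∀ t ∈ Icc s T, ∀ i, |w t i| ≤ R)
    {t : ℝ} (ht : t ∈ Icc s T) :
    dist (v t) (w t) ≤ (dist (v s) (w s) + R * (2 * |σ - σ'| + η + |b - b'|)) *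
      Real.exp ((4 * N + 1 + 4 * R) * (t - s)) := by
  have hs : s ∈ Icc s T := ⟨le_rfl, ht.1.trans ht.2⟩
  have hN : 0 ≤ N := (abs_nonneg _).trans hσ
  have hR : 0 ≤ R := (abs_nonneg _).trans (hvR s hs 0)
  have hη0 : 0 ≤ η := (abs_nonneg _).trans (hη 0)
  have h := norm_le_gronwallBound_of_norm_deriv_right_le (f := fun t => v t - w t)
    (f' := fun t => lorenzField r σ b t (v t) - lorenzField r' σ' b' t (w t))
    (hv.continuousOn.fun_sub hw.continuousOn)
    (fun t ht => (hv.hasDerivWithinAt t ht).sub (hw.hasDerivWithinAt t ht)) le_rfl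
    (fun t ht => norm_lorenzField_sub_le hσ hb (hr t) (hη t) (hvR t (Ico_subset_Icc_self ht))
      (hwR t (Ico_subset_Icc_self ht))) t ht
  rw [dist_eq_norm, dist_eq_norm]
  exact h.trans (gronwallBound_le (by linarith) (by positivity) (sub_nonneg.2 ht.1))

/-- Exponential decay of the energy up to a constant. -/
theorem IsLorenzSolutionOn.lorenzEnergy_le (hv : IsLorenzSolutionOn r σ b s T v) {k : ℝ}
    (hβ : 1 ≤ β) (hr : ∀ t, r t ^ 2 ≤ β) (hk : 0 < k) (hkσ : k ≤ σ) (hkb : k ≤ b) (hk1 : k ≤ 1)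
    {t : ℝ} (ht : t ∈ Icc s T) :
    lorenzEnergy β σ (v t) ≤ lorenzEnergy β σ (v s) * Real.exp (-k * (t - s)) +
      b * β ^ 2 / k * (1 - Real.exp (-k * (t - s))) := by
  have h := le_gronwallBound_of_liminf_deriv_right_le (K := -k) (ε := b * β ^ 2)
    (f := fun t => lorenzEnergy β σ (v t))
    (f' := fun t => lorenzEnergyDeriv β σ (v t) (lorenzField r σ b t (v t)))
    ((continuous_lorenzEnergy β σ).comp_continuousOn hv.continuousOn)
    (fun t ht _ hlt =>
      (hasDerivWithinAt_lorenzEnergy (hv.hasDerivWithinAt t ht)).liminf_right_slope_le hlt) le_rfl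
    (fun t _ => lorenzEnergyDeriv_le hβ (hk.trans_le hkσ) (hk.le.trans hkb) hkσ hkb hk1 (hr t) _) t ht
  rw [gronwallBound_of_K_ne_0 (neg_ne_zero.2 hk.ne')] at h
  refine h.trans_eq ?_
  rw [div_neg]
  ring

theorem IsLorenzSolutionOn.lorenzEnergy_le_max (hv : IsLorenzSolutionOn r σ b s T v) {k c : ℝ}
    (hβ : 1 ≤ β) (hr : ∀ t, r t ^ 2 ≤ β) (hk : 0 < k) (hkσ : k ≤ σ) (hkb : k ≤ b) (hk1 : k ≤ 1)
    (hs : lorenzEnergy β σ (v s) ≤ c) (hc : b * β ^ 2 / k ≤ c) {t : ℝ} (ht : t ∈ Icc s T) :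
    lorenzEnergy β σ (v t) ≤ c := by
  refine (hv.lorenzEnergy_le hβ hr hk hkσ hkb hk1 ht).trans ?_
  have h1 : Real.exp (-k * (t - s)) ≤ 1 :=
    Real.exp_le_one_iff.2 (by nlinarith [mul_nonneg hk.le (sub_nonneg.2 ht.1)])
  -- The decay estimate bounds the energy by a convex combination of its initial value and `bβ²/k`.
  nlinarith [mul_le_mul_of_nonneg_right hs (Real.exp_pos (-k * (t - s))).le,
    mul_le_mul_of_nonneg_right hc (sub_nonneg.2 h1)]

end Solutions

/-! ### Global existence and uniqueness. -/

section Existence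

variable {r : ℝ → ℝ} {σ b s T β : ℝ} {v w : ℝ → E3}

theorem IsLorenzSolutionOn.exists_bound (hv : IsLorenzSolutionOn r σ b s T v) :
    ∃ R, ∀ t ∈ Icc s T, ∀ i, |v t i| ≤ R := by
  obtain ⟨R, hR⟩ := isCompact_Icc.exists_bound_of_continuousOn hv.continuousOn
  exact ⟨R, fun t ht i => (abs_apply_le_norm _ i).trans (hR t ht)⟩

theorem IsLorenzSolutionOn.eq_of_eq {R₀ : ℝ} (hr : ∀ t, |r t| ≤ R₀)
    (hv : IsLorenzSolutionOn r σ b s T v) (hw : IsLorenzSolutionOn r σ b s T w)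
    (h : v s = w s) {t : ℝ} (ht : t ∈ Icc s T) : v t = w t := by
  obtain ⟨R, hR⟩ := hv.exists_bound
  obtain ⟨R', hR'⟩ := hw.exists_bound
  have := dist_le_of_isLorenzSolutionOn (N := max R₀ (max |σ| |b|)) (R := max R R') (η := 0) hv hw
    (le_max_of_le_right (le_max_left _ _)) (le_max_of_le_right (le_max_right _ _))
    (fun t => le_max_of_le_left (hr t)) (by simp)
    (fun t ht i => le_max_of_le_left (hR t ht i)) (fun t ht i => le_max_of_le_right (hR' t ht i)) ht
  simp only [h, dist_self, sub_self, abs_zero, mul_zero, add_zero, zero_mul] at this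
  exact dist_le_zero.1 this

theorem IsLorenzSolution.eqOn {R₀ : ℝ} (hr : ∀ t, |r t| ≤ R₀)
    (hv : IsLorenzSolution r σ b s v) (hw : IsLorenzSolution r σ b s w) (h : v s = w s) :
    EqOn v w (Ici s) :=
  fun t ht => (hv.on t).eq_of_eq hr (hw.on t) h ⟨ht, le_rfl⟩

/-- Truncation of the coordinates of a vector to `[-R, R]`. -/
noncomputable def clampVec (R : ℝ) (v : E3) : E3 :=
  WithLp.toLp 2 fun i => max (-R) (min R (v i))

theorem abs_clampVec_le {R : ℝ} (hR : 0 ≤ R) (v : E3) (i : Fin 3) : |clampVec R v i| ≤ R :=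
  abs_le.2 ⟨le_max_left _ _, max_le (by linarith) (min_le_left _ _)⟩

theorem clampVec_eq_self {R : ℝ} {v : E3} (hv : ∀ i, |v i| ≤ R) : clampVec R v = v := by
  ext i
  have := abs_le.1 (hv i)
  simp [clampVec, this.1, this.2]

theorem norm_clampVec_sub_le (R : ℝ) (v w : E3) :
    ‖clampVec R v - clampVec R w‖ ≤ ‖v - w‖ := by
  rw [EuclideanSpace.norm_eq, EuclideanSpace.norm_eq]
  refine Real.sqrt_le_sqrt (Finset.sum_le_sum fun i _ => ?_)
  refine pow_le_pow_left₀ (norm_nonneg _) ?_ 2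
  have h1 : |max (-R) (min R (v i)) - max (-R) (min R (w i))| ≤ |min R (v i) - min R (w i)| := by
    have := abs_max_sub_max_le_max (-R) (min R (v i)) (-R) (min R (w i))
    simpa using this
  have h2 : |min R (v i) - min R (w i)| ≤ |v i - w i| := by
    have := abs_min_sub_min_le_max R (v i) R (w i)
    simpa using this
  exact h1.trans h2

/-- Existence of solutions on a given time interval of the truncated Lorenz system. -/
theorem exists_truncated_solution (hr : Continuous r) {N R : ℝ} (hrN : ∀ t, |r t| ≤ N)
    (hσ : |σ| ≤ N) (hb : |b| ≤ N) (hR : 0 ≤ R) (hsT : s ≤ T) (x : E3) :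
    ∃ v : ℝ → E3, v s = x ∧ ∀ t ∈ Icc s T,
      HasDerivWithinAt v (lorenzField r σ b t (clampVec R (v t))) (Icc s T) t := by
  have hN : 0 ≤ N := (abs_nonneg _).trans hσ
  have hlip : ∀ t (v w : E3), ‖lorenzField r σ b t (clampVec R v) -
      lorenzField r σ b t (clampVec R w)‖ ≤ (4 * N + 1 + 4 * R) * ‖v - w‖ := by
    intro t v w
    have h := norm_lorenzField_sub_le (r' := r) (σ' := σ) (b' := b) (η := 0) hσ hb (hrN t)
      (by simp) (abs_clampVec_le hR v) (abs_clampVec_le hR w)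
    simp only [sub_self, abs_zero, mul_zero, add_zero] at h
    exact h.trans (mul_le_mul_of_nonneg_left (norm_clampVec_sub_le R v w) (by positivity))
  have hbd : ∀ t (v : E3), ‖lorenzField r σ b t (clampVec R v)‖ ≤
      (4 * N + 1 + 4 * R) * (R + R + R) := by
    intro t v
    have h := norm_lorenzField_sub_le (r' := r) (σ' := σ) (b' := b) (η := 0) (w := 0) hσ hb (hrN t)
      (by simp) (abs_clampVec_le hR v) (by simpa using hR)
    have h0 : lorenzField r σ b t 0 = 0 := by
      ext i
      fin_cases i <;> simp [lorenzField]
    simp only [sub_self, abs_zero, mul_zero, add_zero, h0, sub_zero] at h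
    refine h.trans (mul_le_mul_of_nonneg_left ?_ (by positivity))
    refine (norm_le_sum_abs _).trans ?_
    gcongr <;> exact abs_clampVec_le hR v _
  have hc : 0 ≤ (4 * N + 1 + 4 * R) := by positivity
  have hT : 0 ≤ T - s := sub_nonneg.2 hsT
  -- The truncated field is bounded, so a ball of radius bound times `T - s` contains the solution
  -- on all of `[s, T]`; the initial-value ball has radius `0`.
  have hPL : IsPicardLindelof (fun t v => lorenzField r σ b t (clampVec R v))
      (⟨s, le_rfl, hsT⟩ : Icc s T) x
      (Real.toNNReal ((4 * N + 1 + 4 * R) * (R + R + R) * (T - s))) 0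
      (Real.toNNReal ((4 * N + 1 + 4 * R) * (R + R + R))) (Real.toNNReal (4 * N + 1 + 4 * R)) := by
    refine ⟨fun t _ => ?_, fun v _ => ?_, fun t _ v _ => ?_, ?_⟩
    · refine (LipschitzWith.of_dist_le_mul fun v w => ?_).lipschitzOnWith
      rw [Real.coe_toNNReal _ hc, dist_eq_norm, dist_eq_norm]
      exact hlip t v w
    · refine Continuous.continuousOn ?_
      refine (PiLp.continuous_toLp 2 _).comp (continuous_pi fun i => ?_)
      fin_cases i <;> simp <;> fun_prop
    · rw [Real.coe_toNNReal _ (by positivity)]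
      exact hbd t v
    · rw [Real.coe_toNNReal _ (by positivity), Real.coe_toNNReal _ (by positivity)]
      simp [hT]
  exact hPL.exists_eq_forall_mem_Icc_hasDerivWithinAt₀

theorem exists_solution_Icc (hr : Continuous r) (hβ : 1 ≤ β) (hrβ : ∀ t, r t ^ 2 ≤ β)
    (hσ : 0 < σ) (hb : 0 < b) (hsT : s ≤ T) (x : E3) :
    ∃ v : ℝ → E3, v s = x ∧
      ∀ t ∈ Icc s T, HasDerivWithinAt v (lorenzField r σ b t (v t)) (Icc s T) t := by
  obtain ⟨k, hk, hkσ, hkb, hk1⟩ : ∃ k, 0 < k ∧ k ≤ σ ∧ k ≤ b ∧ k ≤ 1 :=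
    ⟨min (min σ b) 1, by positivity, (min_le_left _ _).trans (min_le_left _ _),
      (min_le_left _ _).trans (min_le_right _ _), min_le_right _ _⟩
  have hrb : ∀ t, |r t| ≤ √β := fun t => Real.abs_le_sqrt (hrβ t)
  -- The summand `1` puts `c` strictly above `bβ²/k`, so the energy strictly decreases at level `c`.
  -- There the truncation is inactive, so the level is never crossed and the truncated solution is a
  -- true one.
  set c := max (lorenzEnergy β σ x) (b * β ^ 2 / k + 1) with hc
  obtain ⟨v, hvs, hv⟩ := exists_truncated_solution (N := max (√β) (max |σ| |b|))
    (R := energyRadius β σ c) hr (fun t => le_max_of_le_left (hrb t))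
    (le_max_of_le_right (le_max_left _ _)) (le_max_of_le_right (le_max_right _ _))
    (Real.sqrt_nonneg _) hsT x
  have hself : ∀ t, lorenzEnergy β σ (v t) ≤ c → clampVec (energyRadius β σ c) (v t) = v t :=
    fun t ht => clampVec_eq_self fun i =>
      (abs_apply_le_norm _ i).trans (norm_le_energyRadius hβ hσ le_rfl ht)
  have hvc : ∀ t ∈ Icc s T, lorenzEnergy β σ (v t) ≤ c := by
    refine image_le_of_deriv_right_lt_deriv_boundary (f := fun t => lorenzEnergy β σ (v t)) (B := fun _ => c) (B' := fun _ => 0)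
      (f' := fun t => lorenzEnergyDeriv β σ (v t)
        (lorenzField r σ b t (clampVec (energyRadius β σ c) (v t))))
      ((continuous_lorenzEnergy β σ).comp_continuousOn fun t ht => (hv t ht).continuousWithinAt)
      (fun t ht => hasDerivWithinAt_lorenzEnergy
        ((hv t (Ico_subset_Icc_self ht)).mono_of_mem_nhdsWithin (Icc_mem_nhdsGE_of_mem ht)))
      (by simp only [hvs]; exact le_max_left _ _) (fun t => hasDerivAt_const t c) fun t _ htc => ?_
    rw [hself t htc.le]
    refine (lorenzEnergyDeriv_le hβ hσ hb.le hkσ hkb hk1 (hrβ t) (v t)).trans_lt ?_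
    have h1 : b * β ^ 2 / k < c := (lt_add_one _).trans_le (le_max_right _ _)
    rw [div_lt_iff₀ hk] at h1
    rw [htc]
    linarith
  refine ⟨v, hvs, fun t ht => ?_⟩
  have := hv t ht
  rwa [hself t (hvc t ht)] at this

theorem isLorenzSolutionOn_of_hasDerivWithinAt_Icc
    (h : ∀ t ∈ Icc s T, HasDerivWithinAt v (lorenzField r σ b t (v t)) (Icc s T) t) :
    IsLorenzSolutionOn r σ b s T v where
  continuousOn t ht := (h t ht).continuousWithinAt
  hasDerivWithinAt t ht :=
    (h t (Ico_subset_Icc_self ht)).mono_of_mem_nhdsWithin (Icc_mem_nhdsGE_of_mem ht)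

theorem exists_isLorenzSolution (hr : Continuous r) (hβ : 1 ≤ β) (hrβ : ∀ t, r t ^ 2 ≤ β)
    (hσ : 0 < σ) (hb : 0 < b) (s : ℝ) (x : E3) :
    ∃ v : ℝ → E3, v s = x ∧ IsLorenzSolution r σ b s v := by
  have hrb : ∀ t, |r t| ≤ √β := fun t => Real.abs_le_sqrt (hrβ t)
  have hex : ∀ T : ℝ, ∃ v : ℝ → E3, s ≤ T → v s = x ∧
      ∀ t ∈ Icc s T, HasDerivWithinAt v (lorenzField r σ b t (v t)) (Icc s T) t := fun T => by
    by_cases hT : s ≤ T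
    · obtain ⟨v, hv⟩ := exists_solution_Icc hr hβ hrβ hσ hb hT x
      exact ⟨v, fun _ => hv⟩
    · exact ⟨fun _ => x, fun h => absurd h hT⟩
  choose u hu using hex
  have heq : ∀ T T' t, s ≤ t → t ≤ T → t ≤ T' → u T t = u T' t := by
    intro T T' t hst hT hT'
    have h1 := hu T (hst.trans hT)
    have h2 := hu T' (hst.trans hT')
    exact ((isLorenzSolutionOn_of_hasDerivWithinAt_Icc h1.2).mono hT).eq_of_eq hrb
      ((isLorenzSolutionOn_of_hasDerivWithinAt_Icc h2.2).mono hT') (h1.1.trans h2.1.symm)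
      ⟨hst, le_rfl⟩
  -- By uniqueness the diagonal agrees with `u (t + 1)` on `[s, t + 1]`, hence near `t`.
  refine ⟨fun t => u t t, (hu s le_rfl).1, fun t ht => ?_⟩
  have ht' : s ≤ t := ht
  have htt : t < t + 1 := lt_add_one t
  have h := (hu (t + 1) (by linarith)).2 t ⟨ht', htt.le⟩
  have h' : HasDerivWithinAt (u (t + 1)) (lorenzField r σ b t (u (t + 1) t)) (Ici s) t := by
    refine h.mono_of_mem_nhdsWithin ?_
    rw [← Ici_inter_Iic]
    exact inter_mem self_mem_nhdsWithin (mem_nhdsWithin_of_mem_nhds (Iic_mem_nhds htt))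
  have hval : u t t = u (t + 1) t := heq _ _ t ht' le_rfl htt.le
  show HasDerivWithinAt (fun t => u t t) (lorenzField r σ b t (u t t)) (Ici s) t
  rw [hval]
  refine h'.congr_of_eventuallyEq ?_ hval
  filter_upwards [self_mem_nhdsWithin, mem_nhdsWithin_of_mem_nhds (Iic_mem_nhds htt)] with τ hτ hτ'
  exact heq _ _ τ hτ le_rfl hτ'

end Existence

/-! ### The Lorenz process, its trapping set and its parameter dependence. -/

section Flow

variable {r : ℝ → ℝ} {R₀ β : ℝ}

theorem exists_lorenzFlow (hr : Continuous r) (hβ : 1 ≤ β) (hrβ : ∀ t, r t ^ 2 ≤ β) :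
    ∃ S : LorenzParam → ℝ → ℝ → E3 → E3, ∀ p s x,
      S p s s x = x ∧ IsLorenzSolution r p.1.1 p.1.2 s (fun t => S p t s x) := by
  choose u hu using fun (p : LorenzParam) s x =>
    exists_isLorenzSolution hr hβ hrβ p.2.1 p.2.2 s x
  exact ⟨fun p t s x => u p s x t, hu⟩

/-- `S` is the solution operator of the Lorenz system. -/
def IsLorenzFlow (r : ℝ → ℝ) (σ b : ℝ) (S : ℝ → ℝ → E3 → E3) : Prop :=
  ∀ s x, S s s x = x ∧ IsLorenzSolution r σ b s (fun t => S t s x)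

theorem IsLorenzFlow.generates {σ b : ℝ} {S : ℝ → ℝ → E3 → E3} (h : IsLorenzFlow r σ b S)
    (hr : ∀ t, |r t| ≤ R₀) : LorenzGenerates r σ b S := by
  refine fun s x v => ⟨fun hv => hv.2.eqOn hr (h s x).2 (hv.1.trans (h s x).1.symm), fun hv => ?_⟩
  exact ⟨(hv self_mem_Ici).trans (h s x).1, (h s x).2.congr hv⟩

/-- A bound for the energy of all solutions starting in the ball of radius `ρ`, for parameters
in `[m, N]`. -/
noncomputable def energyBound (β m N ρ : ℝ) : ℝ :=
  max ((β / m + 3) * ρ ^ 2 + 2 * β ^ 2) (N * β ^ 2 / min m 1)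

theorem abs_apply_le_of_isLorenzSolution {σ b s m N ρ : ℝ} {v : ℝ → E3} (hβ : 1 ≤ β)
    (hrβ : ∀ t, r t ^ 2 ≤ β) (hm : 0 < m) (hσ : σ ∈ Icc m N) (hb : b ∈ Icc m N)
    (hv : IsLorenzSolution r σ b s v) (hvs : ‖v s‖ ≤ ρ) {t : ℝ} (ht : s ≤ t) (i : Fin 3) :
    |v t i| ≤ energyRadius β N (energyBound β m N ρ) := by
  have hk : 0 < min m 1 := by positivity
  have hσ0 := hm.trans_le hσ.1
  refine (abs_apply_le_norm _ i).trans (norm_le_energyRadius hβ hσ0 hσ.2 ?_)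
  refine (hv.on t).lorenzEnergy_le_max hβ hrβ hk ((min_le_left _ _).trans hσ.1)
    ((min_le_left _ _).trans hb.1) (min_le_right _ _) ?_ ?_ ⟨ht, le_rfl⟩
  · refine (lorenzEnergy_le (by linarith) hm hσ.1 _).trans (le_max_of_le_left ?_)
    have : 0 ≤ β / m + 3 := by positivity
    gcongr
  · refine le_max_of_le_right ?_
    have := hb.2
    gcongr

/-- Continuous dependence of the solutions, uniformly on bounded sets and for compact parameter
ranges. -/
theorem exists_dist_le (hβ : 1 ≤ β) {m N ρ : ℝ} (hm : 0 < m) (hN : √β ≤ N) :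
    ∃ C κ : ℝ, 0 ≤ C ∧ 0 ≤ κ ∧ ∀ (r r' : ℝ → ℝ) (σ σ' b b' s η : ℝ) (v w : ℝ → E3),
      (∀ t, r t ^ 2 ≤ β) → (∀ t, r' t ^ 2 ≤ β) → (∀ t, |r t - r' t| ≤ η) →
      σ ∈ Icc m N → σ' ∈ Icc m N → b ∈ Icc m N → b' ∈ Icc m N →
      IsLorenzSolution r σ b s v → IsLorenzSolution r' σ' b' s w → ‖v s‖ ≤ ρ → ‖w s‖ ≤ ρ →
      ∀ t, s ≤ t → dist (v t) (w t) ≤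
        (dist (v s) (w s) + C * (2 * |σ - σ'| + η + |b - b'|)) * Real.exp (κ * (t - s)) := by
  have hN0 : 0 ≤ N := (Real.sqrt_nonneg _).trans hN
  refine ⟨energyRadius β N (energyBound β m N ρ), 4 * N + 1 + 4 * energyRadius β N
    (energyBound β m N ρ), Real.sqrt_nonneg _, ?_, ?_⟩
  · have : 0 ≤ energyRadius β N (energyBound β m N ρ) := Real.sqrt_nonneg _
    positivity
  · intro r r' σ σ' b b' s η v w hr hr' hη hσ hσ' hb hb' hv hw hvs hws t ht
    have habs : ∀ {a : ℝ}, a ∈ Icc m N → |a| ≤ N := fun ha => by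
      rw [abs_of_pos (hm.trans_le ha.1)]
      exact ha.2
    exact dist_le_of_isLorenzSolutionOn (hv.on t) (hw.on t) (habs hσ) (habs hb)
      (fun t => (Real.abs_le_sqrt (hr t)).trans hN) hη
      (fun τ hτ => abs_apply_le_of_isLorenzSolution hβ hr hm hσ hb hv hvs hτ.1)
      (fun τ hτ => abs_apply_le_of_isLorenzSolution hβ hr' hm hσ' hb' hw hws hτ.1) ⟨ht, le_rfl⟩

/-- `S(t,s)x` is compared with the orbit of `x₀` from `s₀` after the same elapsed time `t - s`.
Shifted to time `0`, the two forcings differ by at most `R₀|s - s₀|`. -/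
theorem IsLorenzFlow.continuousOn {σ b : ℝ} {S : ℝ → ℝ → E3 → E3} (h : IsLorenzFlow r σ b S)
    (hβ : 1 ≤ β) (hrβ : ∀ t, r t ^ 2 ≤ β) (hrl : ∀ t t', |r t - r t'| ≤ R₀ * |t - t'|)
    (hσ : 0 < σ) (hb : 0 < b) :
    ContinuousOn (fun q : ℝ × ℝ × E3 => S q.1 q.2.1 q.2.2) {q : ℝ × ℝ × E3 | q.2.1 ≤ q.1} := by
  rintro ⟨t₀, s₀, x₀⟩ hq₀
  have hq₀' : s₀ ≤ t₀ := hq₀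
  have hσN : σ ∈ Icc (min σ b) (max (√β) (max σ b)) :=
    ⟨min_le_left _ _, le_max_of_le_right (le_max_left _ _)⟩
  have hbN : b ∈ Icc (min σ b) (max (√β) (max σ b)) :=
    ⟨min_le_right _ _, le_max_of_le_right (le_max_right _ _)⟩
  obtain ⟨C, κ, hC, hκ, hd⟩ := exists_dist_le (m := min σ b) (ρ := ‖x₀‖ + 1) hβ
    (lt_min hσ hb) (le_max_left (√β) (max σ b))
  set F : Filter (ℝ × ℝ × E3) := 𝓝[{q : ℝ × ℝ × E3 | q.2.1 ≤ q.1}] (t₀, s₀, x₀) with hF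
  have hid : Tendsto (fun q : ℝ × ℝ × E3 => q) F (𝓝 (t₀, s₀, x₀)) := nhdsWithin_le_nhds
  have hlt : Tendsto (fun q : ℝ × ℝ × E3 => q.1) F (𝓝 t₀) := (continuous_fst.tendsto _).comp hid
  have hls : Tendsto (fun q : ℝ × ℝ × E3 => q.2.1) F (𝓝 s₀) :=
    (continuous_snd.fst.tendsto _).comp hid
  have hlx : Tendsto (fun q : ℝ × ℝ × E3 => q.2.2) F (𝓝 x₀) :=
    (continuous_snd.snd.tendsto _).comp hid
  have hcen : Tendsto (fun q : ℝ × ℝ × E3 => S (s₀ + (q.1 - q.2.1)) s₀ x₀) F (𝓝 (S t₀ s₀ x₀)) := by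
    have h1 : Tendsto (fun q : ℝ × ℝ × E3 => s₀ + (q.1 - q.2.1)) F (𝓝[Ici s₀] t₀) := by
      refine tendsto_nhdsWithin_iff.2 ⟨?_, ?_⟩
      · simpa using (tendsto_const_nhds (x := s₀)).add (hlt.sub hls)
      · filter_upwards [self_mem_nhdsWithin] with q hq
        have hq' : q.2.1 ≤ q.1 := hq
        exact mem_Ici.2 (by linarith)
    exact ((h s₀ x₀).2.continuousOn t₀ hq₀').tendsto.comp h1
  have hdist : Tendsto (fun q : ℝ × ℝ × E3 =>
      (dist q.2.2 x₀ + C * (2 * |σ - σ| + R₀ * |q.2.1 - s₀| + |b - b|)) *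
        Real.exp (κ * (q.1 - q.2.1))) F (𝓝 0) := by
    have h1 : Tendsto (fun q : ℝ × ℝ × E3 => dist q.2.2 x₀) F (𝓝 0) :=
      tendsto_iff_dist_tendsto_zero.1 hlx
    have h2 : Tendsto (fun q : ℝ × ℝ × E3 => |q.2.1 - s₀|) F (𝓝 0) :=
      tendsto_iff_dist_tendsto_zero.1 hls
    have h3 := (h1.add ((((h2.const_mul R₀).const_add (2 * |σ - σ|)).add_const
      |b - b|).const_mul C)).mul ((Real.continuous_exp.tendsto _).comp ((hlt.sub hls).const_mul κ))
    simpa using h3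
  refine tendsto_of_tendsto_of_dist hcen (squeeze_zero' (Eventually.of_forall fun _ => dist_nonneg)
    ?_ hdist)
  filter_upwards [self_mem_nhdsWithin, hlx.eventually (Metric.ball_mem_nhds x₀ one_pos)]
    with q hq hqx
  have hq' : q.2.1 ≤ q.1 := hq
  have hx : ‖q.2.2‖ ≤ ‖x₀‖ + 1 := by
    have h1 : ‖q.2.2 - x₀‖ < 1 := by simpa [dist_eq_norm] using hqx
    have h2 := norm_add_le x₀ (q.2.2 - x₀)
    rw [add_sub_cancel] at h2
    linarith
  have := hd (fun τ => r (q.2.1 + τ)) (fun τ => r (s₀ + τ)) σ σ b b 0 (R₀ * |q.2.1 - s₀|) _ _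
    (fun _ => hrβ _) (fun _ => hrβ _) (fun τ => by simpa using hrl (q.2.1 + τ) (s₀ + τ))
    hσN hσN hbN hbN (h q.2.1 q.2.2).2.shift (h s₀ x₀).2.shift
    (by simpa [(h q.2.1 q.2.2).1] using hx) (by simp [(h s₀ x₀).1]) (q.1 - q.2.1) (by linarith)
  simp only [add_zero, add_sub_cancel, sub_zero, (h q.2.1 q.2.2).1, (h s₀ x₀).1] at this
  rw [dist_comm]
  exact this

theorem IsLorenzFlow.process {σ b : ℝ} {S : ℝ → ℝ → E3 → E3} (h : IsLorenzFlow r σ b S)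
    (hβ : 1 ≤ β) (hrβ : ∀ t, r t ^ 2 ≤ β) (hrl : ∀ t t', |r t - r t'| ≤ R₀ * |t - t'|)
    (hσ : 0 < σ) (hb : 0 < b) : IsProcess S where
  refl t x := (h t x).1
  comp s τ _ hsτ hτt x := (h τ (S τ s x)).2.eqOn (fun t => Real.abs_le_sqrt (hrβ t))
    ((h s x).2.mono hsτ) (h τ (S τ s x)).1 hτt
  continuousOn := h.continuousOn hβ hrβ hrl hσ hb

/-- The sublevel set of the energy that is a trapping set of the Lorenz system. -/
noncomputable def lorenzTrap (β : ℝ) (p : LorenzParam) : Set E3 :=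
  {v | lorenzEnergy β p.1.1 v ≤ p.1.2 * β ^ 2 / min (min p.1.1 p.1.2) 1 + 1}

theorem lorenzTrap_subset_closedBall (hβ : 1 ≤ β) {m N : ℝ} (hm : 0 < m) {p : LorenzParam}
    (hσ : p.1.1 ∈ Icc m N) (hb : p.1.2 ∈ Icc m N) :
    lorenzTrap β p ⊆ Metric.closedBall 0 (energyRadius β N (N * β ^ 2 / min m 1 + 1)) := by
  intro v hv
  have hv' : lorenzEnergy β p.1.1 v ≤ p.1.2 * β ^ 2 / min (min p.1.1 p.1.2) 1 + 1 := hv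
  have hm' : m ≤ min p.1.1 p.1.2 := le_min hσ.1 hb.1
  have hN := hb.2
  have hN0 : 0 ≤ N := hm.le.trans (hb.1.trans hN)
  rw [mem_closedBall_zero_iff]
  refine norm_le_energyRadius hβ p.2.1 hσ.2 (hv'.trans ?_)
  gcongr

theorem IsLorenzFlow.isTrapping {p : LorenzParam} {S : ℝ → ℝ → E3 → E3}
    (h : IsLorenzFlow r p.1.1 p.1.2 S) (hβ : 1 ≤ β) (hrβ : ∀ t, r t ^ 2 ≤ β) :
    IsTrapping S (lorenzTrap β p) := by
  have hσ := p.2.1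
  have hb := p.2.2
  set k := min (min p.1.1 p.1.2) 1 with hkdef
  have hk : 0 < k := by positivity
  have hkσ : k ≤ p.1.1 := (min_le_left _ _).trans (min_le_left _ _)
  have hkb : k ≤ p.1.2 := (min_le_left _ _).trans (min_le_right _ _)
  have hk1 : k ≤ 1 := min_le_right _ _
  refine ⟨?_, ?_, ?_, ?_⟩
  · refine Metric.isCompact_of_isClosed_isBounded
      (isClosed_le (continuous_lorenzEnergy _ _) continuous_const) ?_
    exact Metric.isBounded_closedBall.subset (lorenzTrap_subset_closedBall hβ (lt_min hσ hb)
      (N := max p.1.1 p.1.2) ⟨min_le_left _ _, le_max_left _ _⟩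
      ⟨min_le_right _ _, le_max_right _ _⟩)
  -- The point of zero energy.
  · refine ⟨!₂[0, 0, β], ?_⟩
    have : 0 ≤ p.1.2 * β ^ 2 / k + 1 := by positivity
    simpa [lorenzTrap, lorenzEnergy] using this
  · intro s t hst x hx
    refine ((h s x).2.on t).lorenzEnergy_le_max hβ hrβ hk hkσ hkb hk1 ?_ (lt_add_one _).le ⟨hst, le_rfl⟩
    rw [(h s x).1]
    exact hx
  · intro B hB
    obtain ⟨ρ, hρ⟩ := hB.exists_norm_le
    set E := (β / p.1.1 + 3) * ρ ^ 2 + 2 * β ^ 2 with hE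
    have hE0 : 0 ≤ E := by positivity
    -- After time `E/k` the bound `e^u ≥ u + 1` makes the decaying term at most `1`, the slack in
    -- `lorenzTrap`.
    refine ⟨E / k, by positivity, fun s t hst x hx => ?_⟩
    have hst' : s ≤ t := by
      have : 0 ≤ E / k := by positivity
      linarith
    have h1 := ((h s x).2.on t).lorenzEnergy_le hβ hrβ hk hkσ hkb hk1 ⟨hst', le_rfl⟩
    rw [(h s x).1] at h1
    have h2 : lorenzEnergy β p.1.1 x ≤ E := by
      refine (lorenzEnergy_le (by linarith) hσ le_rfl x).trans ?_
      have := hρ x hx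
      rw [hE]
      gcongr
    have h3 : E ≤ k * (t - s) := by
      have : E / k ≤ t - s := by linarith
      rw [div_le_iff₀ hk] at this
      linarith
    have h4 : E * Real.exp (-k * (t - s)) ≤ 1 := by
      have := Real.add_one_le_exp (k * (t - s))
      rw [neg_mul, Real.exp_neg, ← div_eq_mul_inv, div_le_one (Real.exp_pos _)]
      linarith
    have h5 := Real.exp_pos (-k * (t - s))
    have h6 : 0 ≤ p.1.2 * β ^ 2 / k := by positivity
    show lorenzEnergy β p.1.1 (S t s x) ≤ p.1.2 * β ^ 2 / k + 1
    nlinarith [mul_le_mul_of_nonneg_right h2 h5.le, mul_nonneg h6 h5.le]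

/-- The energy constants degenerate as a parameter tends to `0` or `∞`, so estimates are made on
compact parameter ranges. -/
theorem exists_nhds_param_bounds (p : LorenzParam) (N₀ : ℝ) :
    ∃ m N : ℝ, 0 < m ∧ N₀ ≤ N ∧ ∀ᶠ q : LorenzParam in 𝓝 p,
      q.1.1 ∈ Icc m N ∧ q.1.2 ∈ Icc m N := by
  have hσ := p.2.1
  have hb := p.2.2
  have h1 : Tendsto (fun q : LorenzParam => q.1.1) (𝓝 p) (𝓝 p.1.1) :=
    continuous_subtype_val.fst.tendsto p
  have h2 : Tendsto (fun q : LorenzParam => q.1.2) (𝓝 p) (𝓝 p.1.2) :=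
    continuous_subtype_val.snd.tendsto p
  refine ⟨min (p.1.1 / 2) (p.1.2 / 2), max N₀ (max (p.1.1 + 1) (p.1.2 + 1)), by positivity,
    le_max_left _ _, ?_⟩
  filter_upwards [h1.eventually (Icc_mem_nhds (half_lt_self hσ) (lt_add_one _)),
    h2.eventually (Icc_mem_nhds (half_lt_self hb) (lt_add_one _))] with q hq1 hq2
  exact ⟨⟨(min_le_left _ _).trans hq1.1, hq1.2.trans (le_max_of_le_right (le_max_left _ _))⟩,
    ⟨(min_le_right _ _).trans hq2.1, hq2.2.trans (le_max_of_le_right (le_max_right _ _))⟩⟩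

theorem isContinuousFamily_lorenz {S : LorenzParam → ℝ → ℝ → E3 → E3}
    (h : ∀ p, IsLorenzFlow r p.1.1 p.1.2 (S p)) (hβ : 1 ≤ β) (hrβ : ∀ t, r t ^ 2 ≤ β)
    (hrl : ∀ t t', |r t - r t'| ≤ R₀ * |t - t'|) : IsContinuousFamily S (lorenzTrap β) where
  process p := (h p).process hβ hrβ hrl p.2.1 p.2.2
  isTrapping p := (h p).isTrapping hβ hrβ
  locallyBounded p := by
    obtain ⟨m, N, hm, -, hq⟩ := exists_nhds_param_bounds p 0
    exact ⟨_, Metric.isBounded_closedBall,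
      hq.mono fun q hq => lorenzTrap_subset_closedBall hβ hm hq.1 hq.2⟩
  continuous p B hB t ht ε hε := by
    obtain ⟨m, N, hm, hN, hq⟩ := exists_nhds_param_bounds p (√β)
    obtain ⟨ρ, hρ⟩ := hB.exists_norm_le
    obtain ⟨C, κ, hC, hκ, hd⟩ := exists_dist_le (ρ := ρ) hβ hm hN
    have hcont : Continuous fun q : LorenzParam =>
        C * (2 * |q.1.1 - p.1.1| + 0 + |q.1.2 - p.1.2|) * Real.exp (κ * t) := by fun_prop
    have hlim := hcont.tendsto p
    simp only [sub_self, abs_zero, mul_zero, add_zero, zero_mul] at hlim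
    filter_upwards [hq, hlim.eventually_lt_const hε] with q hqm hqε s x hx
    have hp := hq.self_of_nhds
    have := hd r r q.1.1 p.1.1 q.1.2 p.1.2 s 0 _ _ hrβ hrβ (by simp) hqm.1 hp.1 hqm.2 hp.2
      (h q s x).2 (h p s x).2 (by rw [(h q s x).1]; exact hρ x hx)
      (by rw [(h p s x).1]; exact hρ x hx) (s + t) (by linarith)
    refine this.trans_lt ?_
    simpa [(h q s x).1, (h p s x).1] using hqε

end Flow

theorem isOpen_lorenzParam : IsOpen {p : ℝ × ℝ | 0 < p.1 ∧ 0 < p.2} :=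
  (isOpen_lt continuous_const continuous_fst).inter (isOpen_lt continuous_const continuous_snd)

/-- Makes the parameter space a Baire space, where residual sets are dense. -/
instance : LocallyCompactSpace LorenzParam :=
  isOpen_lorenzParam.locallyCompactSpace

end NonautonomousLorenz

theorem theorem6p3 (r : ℝ → ℝ) (hr : ContDiff ℝ 1 r) (R₀ : ℝ)
    (hR₀ : ∀ t : ℝ, |r t| ≤ R₀ ∧ |deriv r t| ≤ R₀) :
    ∃ (S : LorenzParam → ℝ → ℝ → E3 → E3)
      (A : LorenzParam → ℝ → TopologicalSpace.NonemptyCompacts E3)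
      (U : LorenzParam → TopologicalSpace.NonemptyCompacts E3),
      (∀ p : LorenzParam,
        NonautonomousLorenz.LorenzGenerates r p.1.1 p.1.2 (S p) ∧
        NonautonomousLorenz.IsProcess (S p) ∧
        NonautonomousLorenz.IsPullbackAttractor (S p) (fun t => (A p t : Set E3)) ∧
        NonautonomousLorenz.IsUniformAttractor (S p) (U p : Set E3)) ∧
      ∃ L : Set LorenzParam, L ∈ residual LorenzParam ∧ Dense L ∧
        ∀ p ∈ L, (∀ t : ℝ, ContinuousAt (fun q : LorenzParam => A q t) p) ∧
          ContinuousAt U p := by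
  have hβ : 1 ≤ R₀ ^ 2 + 1 := by nlinarith [sq_nonneg R₀]
  have hrβ : ∀ t, r t ^ 2 ≤ R₀ ^ 2 + 1 := fun t => by
    have := sq_le_sq' (abs_le.1 (hR₀ t).1).1 (abs_le.1 (hR₀ t).1).2
    linarith
  -- The bound on `r'` enters only as this Lipschitz bound, used for continuity in the initial time.
  have hrl : ∀ t t', |r t - r t'| ≤ R₀ * |t - t'| := fun t t' =>
    convex_univ.norm_image_sub_le_of_norm_deriv_le
      (fun x _ => (hr.differentiable one_ne_zero).differentiableAt) (fun x _ => (hR₀ x).2)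
      (mem_univ t') (mem_univ t)
  obtain ⟨S, hS⟩ := NonautonomousLorenz.exists_lorenzFlow hr.continuous hβ hrβ
  have hfam := NonautonomousLorenz.isContinuousFamily_lorenz hS hβ hrβ hrl
  obtain ⟨A, U, hAU, L, hL, hcont⟩ := hfam.exists_attractors
  exact ⟨S, A, U, fun p => ⟨NonautonomousLorenz.IsLorenzFlow.generates (hS p) fun t => (hR₀ t).1,
    hfam.process p, (hAU p).1, (hAU p).2⟩, L, hL, dense_of_mem_residual hL, hcont⟩
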